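/- For every nonnegative integer $n$ let $W_n=\sum_{k=0}^{n}\binom{n+k}{2k}\binom{2k}{k}\frac{3}{2k-3}$. Then every $W_n$ is an integer, and the following congruences hold. For every positive integer $n$, $$9\sum_{k=0}^{n-1}(2k+1)W_k^2\equiv 0\pmod{n}.$$ For every prime $p>3$, $$\sum_{k=0}^{p-1}(2k+1)W_k^2\equiv 12p(-1)^{\frac{p-1}{2}}-17p^2\pmod{p^3}.$$ -/

import Mathlib

/-- The numbers `W_n = ∑_{k=0}^n C(n+k,2k) C(2k,k) · 3/(2k-3)`, as rational numbers.
The denominator `2k - 3` is computed in `ℚ` and never vanishes. -/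
def W (n : ℕ) : ℚ :=
  ∑ k ∈ Finset.range (n + 1),
    ((n + k).choose (2 * k) : ℚ) * ((2 * k).choose k : ℚ) * (3 / (2 * (k : ℚ) - 3))

open Finset

/-! Let D_n be the central Delannoy numbers. W satisfies a first-order recurrence with inhomogeneous
term 3(D_{n+1} + D_n) (`intW_succ`), and D a three-term one, so the sum telescopes:
8((2n-1)(2n+1)(2n+3))^2 S_n = n Q_n, with Q_n quadratic in W_n, D_n, D_{n-1}
(`weighted_sum_sq_intW`). Modulo n the squared product is 9. The 8 is coprime to odd n, and divides
Q_n for even n because W and D are odd. For n = p the factor p reduces the claim modulo p^3 to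
values modulo p^2. The constant part of Q is -108(d+e)(w+d), so only D_p + D_{p-1} and W_p + D_p are
needed to that precision, the rest modulo p. They follow from k C(p,k) C(p+k,k) ≡ p(-1)^(k-1), with
terms of W_p + D_p cancelling in pairs. -/

/-- The coefficient of `x ^ k` in the shifted Legendre polynomial `P_n(1 + 2 x)`. -/
def legendreCoeff (n k : ℕ) : ℤ := (n.choose k : ℤ) * ((n + k).choose k : ℤ)

/-- The central Delannoy numbers. -/
def delannoy (n : ℕ) : ℤ := ∑ k ∈ range (n + 1), legendreCoeff n k

/-- The integers `3 * C(2k, k) / (2k - 3)`. -/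
def centralBinomQuot (k : ℕ) : ℤ := 3 * (k.centralBinom : ℤ) / (2 * (k : ℤ) - 3)

/-- The integer form of `W`. -/
def intW (n : ℕ) : ℤ := ∑ k ∈ range (n + 1), ((n + k).choose (2 * k) : ℤ) * centralBinomQuot k

/-! ### Binomial identities and the Delannoy recurrence -/

theorem choose_succ_mul_sub (n k : ℕ) :
    ((n + 1).choose k : ℤ) * (n + 1 - k) = (n + 1) * (n.choose k : ℤ) := by
  rcases le_or_gt k (n + 1) with h | h
  · have := Nat.choose_mul_succ_eq n k
    zify [h] at this
    linarith
  · simp [Nat.choose_eq_zero_of_lt h, Nat.choose_eq_zero_of_lt (show n < k by omega)]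

theorem choose_succ_right_mul (n k : ℕ) :
    (n.choose (k + 1) : ℤ) * (k + 1) = (n.choose k : ℤ) * (n - k) := by
  rcases le_or_gt k n with h | h
  · have := Nat.choose_succ_right_eq n k
    zify [h] at this
    linarith
  · simp [Nat.choose_eq_zero_of_lt h, Nat.choose_eq_zero_of_lt (show n < k + 1 by omega)]

theorem choose_succ_succ_mul (n k : ℕ) :
    ((n + 1).choose (k + 1) : ℤ) * (k + 1) = (n + 1) * (n.choose k : ℤ) := by
  have := Nat.add_one_mul_choose_eq n k
  zify at this
  linarith

theorem legendreCoeff_succ_left (n k : ℕ) :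
    ((n : ℤ) + 1 - k) * legendreCoeff (n + 1) k = (n + 1 + k) * legendreCoeff n k := by
  have h1 := choose_succ_mul_sub n k
  have h2 := choose_succ_mul_sub (n + k) k
  have h3 : ((n : ℤ) + 1) ≠ 0 := by positivity
  apply mul_left_cancel₀ h3
  unfold legendreCoeff
  rw [show n + 1 + k = n + k + 1 by ring]
  push_cast at h2
  linear_combination ((n + k + 1).choose k : ℤ) * (n + 1) * h1 + (n + 1) * (n.choose k : ℤ) * h2

theorem legendreCoeff_succ_right (n k : ℕ) :
    ((k : ℤ) + 1) ^ 2 * legendreCoeff n (k + 1) = (n - k) * (n + k + 1) * legendreCoeff n k := by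
  have h1 := choose_succ_right_mul n k
  have h2 := choose_succ_succ_mul (n + k) k
  unfold legendreCoeff
  rw [show n + (k + 1) = n + k + 1 by ring]
  push_cast at h2
  linear_combination ((n + k + 1).choose (k + 1) : ℤ) * (k + 1) * h1
    + (n.choose k : ℤ) * (n - k) * h2

theorem legendreCoeff_eq_zero {n k : ℕ} (h : n < k) : legendreCoeff n k = 0 := by
  simp [legendreCoeff, Nat.choose_eq_zero_of_lt h]

theorem legendreCoeff_zero_right (n : ℕ) : legendreCoeff n 0 = 1 := by
  simp [legendreCoeff]

theorem choose_mul_centralBinom (n k : ℕ) :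
    ((n + k).choose (2 * k) : ℤ) * (k.centralBinom : ℤ) = legendreCoeff n k := by
  rcases le_or_gt k n with h | h
  · have := Nat.choose_mul (n := n + k) (k := 2 * k) (s := k) (by omega)
    rw [show n + k - k = n by omega, show 2 * k - k = k by omega] at this
    unfold legendreCoeff Nat.centralBinom
    zify at this
    linarith
  · simp [legendreCoeff_eq_zero h, Nat.choose_eq_zero_of_lt (show n + k < 2 * k by omega)]

theorem legendreCoeff_three_term (n k : ℕ) :
    ((n : ℤ) + 2) * legendreCoeff (n + 2) (k + 1)
      - (2 * n + 3) * (legendreCoeff (n + 1) (k + 1) + 2 * legendreCoeff (n + 1) k)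
      + (n + 1) * legendreCoeff n (k + 1) = 0 := by
  rcases lt_trichotomy k (n + 1) with h | h | h
  · have e1 := legendreCoeff_succ_left n k
    have e2 := legendreCoeff_succ_right (n + 1) k
    have e3 := legendreCoeff_succ_left (n + 1) (k + 1)
    have e4 := legendreCoeff_succ_right n k
    have hk : ((n : ℤ) + 1 - k) ≠ 0 := by
      have : (k : ℤ) < n + 1 := by exact_mod_cast h
      linarith
    have hk' : ((k : ℤ) + 1) ^ 2 ≠ 0 := by positivity
    push_cast at *
    apply mul_left_cancel₀ (mul_ne_zero hk hk')
    linear_combination (k + 1 : ℤ) ^ 2 * (n + 2) * e3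
      + ((n + 2 : ℤ) * (n + k + 3) - (2 * n + 3) * (n + 1 - k)) * e2
      + (n + 1 : ℤ) * (n + 1 - k) * e4
      - (n + 1 : ℤ) * (n + 1 - k) * (n - k) * e1
  · subst h
    have e2 := legendreCoeff_succ_right (n + 2) (n + 1)
    have e1 := legendreCoeff_succ_left (n + 1) (n + 1)
    rw [legendreCoeff_eq_zero (show n + 1 < n + 1 + 1 by omega),
      legendreCoeff_eq_zero (show n < n + 1 + 1 by omega)]
    have hn : ((n : ℤ) + 2) ≠ 0 := by positivity
    push_cast at *
    apply mul_left_cancel₀ hn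
    linear_combination e2 + (2 * n + 4 : ℤ) * e1
  · rw [legendreCoeff_eq_zero (show n + 1 < k by omega),
      legendreCoeff_eq_zero (show n + 1 < k + 1 by omega),
      legendreCoeff_eq_zero (show n < k + 1 by omega),
      legendreCoeff_eq_zero (show n + 2 < k + 1 by omega)]
    ring

theorem delannoy_eq_sum_range {n N : ℕ} (h : n < N) :
    delannoy n = ∑ k ∈ range N, legendreCoeff n k := by
  unfold delannoy
  apply Finset.sum_subset
  · intro x; simp; omega
  · intro x _ hx
    apply legendreCoeff_eq_zero
    simpa using hx

theorem delannoy_three_term (n : ℕ) :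
    ((n : ℤ) + 2) * delannoy (n + 2) = 3 * (2 * n + 3) * delannoy (n + 1)
      - (n + 1) * delannoy n := by
  have h := Finset.sum_congr (rfl : range (n + 2) = range (n + 2))
    (fun k _ => legendreCoeff_three_term n k)
  simp only [Finset.sum_add_distrib, Finset.sum_sub_distrib, ← Finset.mul_sum,
    Finset.sum_const_zero] at h
  have a2 := delannoy_eq_sum_range (n := n + 2) (N := n + 2 + 1) (by omega)
  have a1 := delannoy_eq_sum_range (n := n + 1) (N := n + 2 + 1) (by omega)
  have a1' := delannoy_eq_sum_range (n := n + 1) (N := n + 2) (by omega)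
  have a0 := delannoy_eq_sum_range (n := n) (N := n + 2 + 1) (by omega)
  rw [Finset.sum_range_succ', legendreCoeff_zero_right] at a2 a1 a0
  linear_combination h + (n + 2 : ℤ) * a2 - (2 * n + 3 : ℤ) * a1 + (n + 1 : ℤ) * a0
    - 2 * (2 * n + 3 : ℤ) * a1'

/-! ### Integrality of W and its recurrence -/

theorem two_mul_sub_three_ne_zero (k : ℕ) : (2 * (k : ℤ) - 3) ≠ 0 := by omega

theorem two_mul_sub_three_dvd (k : ℕ) : (2 * (k : ℤ) - 3) ∣ 3 * (k.centralBinom : ℤ) := by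
  match k with
  | 0 => norm_num
  | 1 => norm_num
  | k + 2 =>
    have h1 := Nat.succ_mul_centralBinom_succ (k + 1)
    have h2 := Nat.succ_mul_centralBinom_succ k
    zify at h1 h2
    push_cast at *
    -- Comes from 4(k+1)(k+2) - (2k+1)(2k+5) = 3.
    refine ⟨16 * (2 * k + 3) * (k.centralBinom : ℤ)
      - (2 * k + 5) * ((k + 1 + 1).centralBinom : ℤ), ?_⟩
    linear_combination (4 * (k + 1) : ℤ) * h1 + 8 * (2 * k + 3 : ℤ) * h2

theorem mul_centralBinomQuot (k : ℕ) :
    (2 * (k : ℤ) - 3) * centralBinomQuot k = 3 * (k.centralBinom : ℤ) :=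
  Int.mul_ediv_cancel' (two_mul_sub_three_dvd k)

theorem intW_cast (n : ℕ) : (intW n : ℚ) = W n := by
  unfold intW W
  push_cast
  refine Finset.sum_congr rfl fun k _ => ?_
  have h : ((2 * (k : ℤ) - 3 : ℤ) : ℚ) ≠ 0 := by exact_mod_cast two_mul_sub_three_ne_zero k
  have e : ((2 * (k : ℤ) - 3 : ℤ) : ℚ) * (centralBinomQuot k : ℚ) = 3 * (k.centralBinom : ℚ) := by
    exact_mod_cast mul_centralBinomQuot k
  push_cast at h e
  rw [mul_assoc, ← Nat.centralBinom_eq_two_mul_choose]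
  congr 1
  field_simp
  linear_combination e

theorem intW_eq_sum_range {n N : ℕ} (h : n < N) :
    intW n = ∑ k ∈ range N, ((n + k).choose (2 * k) : ℤ) * centralBinomQuot k := by
  unfold intW
  apply Finset.sum_subset
  · intro x; simp; omega
  · intro x _ hx
    rw [Nat.choose_eq_zero_of_lt]
    · simp
    · simp at hx; omega

/-- Termwise, with A = C(n+k,2k) and A' = C(n+1+k,2k), (2n-1)A' - (2n+5)A = (2k-3)(A' + A), which
cancels the denominator. -/
theorem intW_succ (n : ℕ) :
    (2 * (n : ℤ) - 1) * intW (n + 1)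
      = (2 * n + 5) * intW n + 3 * (delannoy (n + 1) + delannoy n) := by
  rw [intW_eq_sum_range (n := n + 1) (N := n + 2) (by omega),
    intW_eq_sum_range (n := n) (N := n + 2) (by omega),
    delannoy_eq_sum_range (n := n + 1) (N := n + 2) (by omega),
    delannoy_eq_sum_range (n := n) (N := n + 2) (by omega),
    ← Finset.sum_add_distrib, Finset.mul_sum, Finset.mul_sum, Finset.mul_sum,
    ← Finset.sum_add_distrib]
  refine Finset.sum_congr rfl fun k _ => ?_
  have e := legendreCoeff_succ_left n k
  have q := mul_centralBinomQuot k
  have c0 := choose_mul_centralBinom n k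
  have c1 := choose_mul_centralBinom (n + 1) k
  apply mul_left_cancel₀ (two_mul_sub_three_ne_zero k)
  linear_combination ((2 * n - 1 : ℤ) * ((n + 1 + k).choose (2 * k) : ℤ)
      - (2 * n + 5 : ℤ) * ((n + k).choose (2 * k) : ℤ)) * q
    + 3 * (2 * n - 1 : ℤ) * c1 - 3 * (2 * n + 5 : ℤ) * c0 + 6 * e

/-! ### Telescoping the weighted sum of squares -/

/-- The quadratic form in `intW n`, `delannoy n`, `delannoy (n - 1)` that evaluates
`∑ k < n, (2 k + 1) * intW k ^ 2` up to a factor. -/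
def sumSqForm {R : Type*} [CommRing R] (n w d e : R) : R :=
  (-360 * n + 944 * n ^ 3 - 640 * n ^ 5 + 128 * n ^ 7) * w ^ 2
    + (-108 - 792 * n - 360 * n ^ 2 + 1152 * n ^ 3 + 1152 * n ^ 4 - 576 * n ^ 5
        - 576 * n ^ 6) * w * d
    + (-108 - 72 * n + 120 * n ^ 2 + 576 * n ^ 3 + 768 * n ^ 4 + 576 * n ^ 5
        + 192 * n ^ 6) * w * e
    + (-108 - 495 * n - 576 * n ^ 2 - 360 * n ^ 3 + 432 * n ^ 4 + 360 * n ^ 5) * d ^ 2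
    + (-108 - 486 * n - 432 * n ^ 2 + 2160 * n ^ 3 + 3456 * n ^ 4 + 1296 * n ^ 5) * d * e
    + (9 * n + 144 * n ^ 2 - 72 * n ^ 3 - 432 * n ^ 4 - 216 * n ^ 5) * e ^ 2

/-- The factors (2n+5)^2 and (2n-1)^2 come from shifting the prefactor (2n-1)(2n+1)(2n+3).
Eliminating e and w' leaves a rational function identity. -/
theorem sumSqForm_step {n w w' d d' e : ℚ} (h0 : n ≠ 0) (h1 : 2 * n - 1 ≠ 0)
    (hw : (2 * n - 1) * w' = (2 * n + 5) * w + 3 * (d' + d))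
    (hd : (n + 1) * d' = 3 * (2 * n + 1) * d - n * e) :
    (2 * n - 1) ^ 2 * ((n + 1) * sumSqForm (n + 1) w' d' d)
      = (2 * n + 5) ^ 2 * (n * sumSqForm n w d e
        + 8 * ((2 * n - 1) * (2 * n + 1) * (2 * n + 3)) ^ 2 * ((2 * n + 1) * w ^ 2)) := by
  have he : e = (3 * (2 * n + 1) * d - (n + 1) * d') / n := by field_simp; linarith
  have hw' : w' = ((2 * n + 5) * w + 3 * (d' + d)) / (2 * n - 1) := by field_simp; linarith
  subst he hw'
  unfold sumSqForm
  field_simp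
  ring

theorem weighted_sum_sq_intW (m : ℕ) :
    8 * ((2 * (m + 1 : ℤ) - 1) * (2 * (m + 1) + 1) * (2 * (m + 1) + 3)) ^ 2 *
      ∑ k ∈ range (m + 1), (2 * (k : ℤ) + 1) * intW k ^ 2
      = (m + 1) * sumSqForm (m + 1 : ℤ) (intW (m + 1)) (delannoy (m + 1)) (delannoy m) := by
  induction m with
  | zero =>
    have q0 := mul_centralBinomQuot 0
    have q1 := mul_centralBinomQuot 1
    norm_num [Nat.centralBinom, Nat.choose] at q0 q1
    have e0 : intW 0 = -1 := by simp [intW]; linarith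
    have e1 : intW 1 = -7 := by simp [intW, Finset.sum_range_succ]; linarith
    have e2 : delannoy 0 = 1 := by simp [delannoy, legendreCoeff]
    have e3 : delannoy 1 = 3 := by simp [delannoy, Finset.sum_range_succ, legendreCoeff]
    simp [e0, e1, e2, e3, sumSqForm]
  | succ m ih =>
    rw [Finset.sum_range_succ]
    have hw := intW_succ (m + 1)
    have hd := delannoy_three_term m
    have key := sumSqForm_step (n := (m + 1 : ℚ)) (w := intW (m + 1)) (w' := intW (m + 2))
      (d := delannoy (m + 1)) (d' := delannoy (m + 2)) (e := delannoy m)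
      (by positivity) (by ring_nf; positivity) (by exact_mod_cast hw)
      (by have : ((m : ℚ) + 2) * delannoy (m + 2) = 3 * (2 * m + 3) * delannoy (m + 1)
            - (m + 1) * delannoy m := by exact_mod_cast hd
          linear_combination this)
    have key' : (2 * (m + 1 : ℤ) - 1) ^ 2 * (((m + 1 : ℤ) + 1) * sumSqForm ((m + 1 : ℤ) + 1)
          (intW (m + 2)) (delannoy (m + 2)) (delannoy (m + 1)))
        = (2 * (m + 1 : ℤ) + 5) ^ 2 * ((m + 1) * sumSqForm (m + 1 : ℤ) (intW (m + 1))
            (delannoy (m + 1)) (delannoy m)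
          + 8 * ((2 * (m + 1 : ℤ) - 1) * (2 * (m + 1) + 1) * (2 * (m + 1) + 3)) ^ 2 *
            ((2 * (m + 1) + 1) * intW (m + 1) ^ 2)) := by
      unfold sumSqForm at key ⊢
      exact_mod_cast key
    have hc : (2 * (m + 1 : ℤ) - 1) ^ 2 ≠ 0 := by
      apply pow_ne_zero; omega
    apply mul_left_cancel₀ hc
    push_cast
    linear_combination (2 * (m + 1 : ℤ) + 5) ^ 2 * ih - key'

/-! ### Parity and divisibility by n -/

theorem delannoy_odd (n : ℕ) : Odd (delannoy n) := by
  unfold delannoy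
  rw [Finset.sum_range_succ', legendreCoeff_zero_right]
  refine Even.add_one ?_
  refine Finset.even_sum _ fun k _ => ?_
  rw [← choose_mul_centralBinom]
  refine Even.mul_left ?_ _
  exact_mod_cast even_iff_two_dvd.2 (Nat.two_dvd_centralBinom_succ k)

theorem intW_odd (n : ℕ) : Odd (intW n) := by
  have hd := delannoy_odd n
  have h : Even (intW n + delannoy n) := by
    unfold intW delannoy
    rw [← Finset.sum_add_distrib]
    refine Finset.even_sum _ fun k _ => ?_
    rw [← choose_mul_centralBinom, ← mul_add]
    refine Even.mul_left ?_ _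
    have q := mul_centralBinomQuot k
    have q' : (2 * (k : ℤ) - 3) * (centralBinomQuot k + k.centralBinom)
      = 2 * (k * (k.centralBinom : ℤ)) := by linear_combination q
    have h2 : Even ((2 * (k : ℤ) - 3) * (centralBinomQuot k + k.centralBinom)) := by
      rw [q']; exact even_two_mul _
    rcases Int.even_mul.1 h2 with h3 | h3
    · exfalso
      obtain ⟨r, hr⟩ := h3
      omega
    · exact h3
  obtain ⟨a, ha⟩ := h
  obtain ⟨b, hb⟩ := hd
  exact ⟨a - b - 1, by linarith⟩

theorem eight_dvd_sumSqForm {n w d e : ℤ} (hn : Even n) (hw : Odd w) (hd : Odd d) (he : Odd e) :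
    8 ∣ sumSqForm n w d e := by
  obtain ⟨m, rfl⟩ := hn
  obtain ⟨a, ha⟩ := hw.add_odd hd
  obtain ⟨b, hb⟩ := hd.add_odd he
  obtain rfl : w = a + a - d := by linarith
  obtain rfl : e = b + b - d := by linarith
  generalize hN : m + m = n
  -- The constant part is -108(2a)(2b). The part linear in n without w collapses to 36nb(b-28d) with
  -- n = 2m; every other coefficient is a multiple of 8.
  refine ⟨-54 * a * b + 9 * m * b * (b - 28 * d)
    + (-45 * n + 118 * n ^ 3 - 80 * n ^ 5 + 16 * n ^ 7) * (a + a - d) ^ 2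
    + (-99 * n - 45 * n ^ 2 + 144 * n ^ 3 + 144 * n ^ 4 - 72 * n ^ 5
        - 72 * n ^ 6) * (a + a - d) * d
    + (-9 * n + 15 * n ^ 2 + 72 * n ^ 3 + 96 * n ^ 4 + 72 * n ^ 5
        + 24 * n ^ 6) * (a + a - d) * (b + b - d)
    + (-72 * n ^ 2 - 45 * n ^ 3 + 54 * n ^ 4 + 45 * n ^ 5) * d ^ 2
    + (-54 * n ^ 2 + 270 * n ^ 3 + 432 * n ^ 4 + 162 * n ^ 5) * d * (b + b - d)
    + (18 * n ^ 2 - 9 * n ^ 3 - 54 * n ^ 4 - 27 * n ^ 5) * (b + b - d) ^ 2, ?_⟩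
  unfold sumSqForm
  linear_combination (-36 * b * (b - 28 * d)) * hN

theorem nine_mul_sum_dvd (n : ℕ) (hn : 0 < n) :
    (n : ℤ) ∣ 9 * ∑ k ∈ range n, (2 * (k : ℤ) + 1) * intW k ^ 2 := by
  obtain ⟨m, rfl⟩ := Nat.exists_eq_succ_of_ne_zero hn.ne'
  have h := weighted_sum_sq_intW m
  set S := ∑ k ∈ range (m + 1), (2 * (k : ℤ) + 1) * intW k ^ 2
  set q := sumSqForm (m + 1 : ℤ) (intW (m + 1)) (delannoy (m + 1)) (delannoy m)
  have h8 : ((m + 1 : ℕ) : ℤ) ∣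
      ((2 * (m + 1 : ℤ) - 1) * (2 * (m + 1) + 1) * (2 * (m + 1) + 3)) ^ 2 * S := by
    rcases Int.even_or_odd (m + 1 : ℤ) with hm | hm
    · obtain ⟨r, hr⟩ := eight_dvd_sumSqForm hm (intW_odd (m + 1)) (delannoy_odd (m + 1))
        (delannoy_odd m)
      refine ⟨r, ?_⟩
      push_cast
      have : (8 : ℤ) ≠ 0 := by norm_num
      apply mul_left_cancel₀ this
      linear_combination h + (m + 1 : ℤ) * hr
    · have hc : IsCoprime ((m + 1 : ℕ) : ℤ) (8 : ℤ) := by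
        have : IsCoprime ((m + 1 : ℕ) : ℤ) (2 : ℤ) := by
          obtain ⟨r, hr⟩ := hm
          exact ⟨1, -r, by push_cast; linarith⟩
        exact this.pow_right (n := 3)
      refine hc.dvd_of_dvd_mul_left ⟨q, ?_⟩
      push_cast
      linear_combination h
  obtain ⟨r, hr⟩ := h8
  set N : ℤ := m + 1 with hN
  push_cast at hr ⊢
  rw [← hN] at hr ⊢
  -- The polynomial is (((2N-1)(2N+1)(2N+3))^2 - 9)/N.
  refine ⟨r - (64 * N ^ 5 + 192 * N ^ 4 + 112 * N ^ 3 - 96 * N ^ 2 - 68 * N + 12) * S, ?_⟩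
  linear_combination hr

/-! ### Values at a prime modulo p^2 -/

section PrimeSq

variable {p : ℕ}

theorem isUnit_natCast_zmod_pow [hp : Fact p.Prime] {r k : ℕ} (h0 : 0 < k) (h : k < p) :
    IsUnit (k : ZMod (p ^ r)) := by
  rw [ZMod.isUnit_iff_coprime]
  exact Nat.Coprime.pow_right _ (Nat.coprime_of_lt_prime h0.ne' h hp.out).symm

theorem natCast_sq_zmod_sq : (p : ZMod (p ^ 2)) ^ 2 = 0 := by
  exact_mod_cast ZMod.natCast_self (p ^ 2)

/-- `C(p - 1, h) * C(p + h, h) ≡ (-1) ^ h` modulo `p ^ 2`. -/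
theorem choose_pred_mul_choose_add [Fact p.Prime] {h : ℕ} (hh : h < p) :
    (((p - 1).choose h : ℤ) : ZMod (p ^ 2)) * (((p + h).choose h : ℤ) : ZMod (p ^ 2))
      = (-1) ^ h := by
  induction h with
  | zero => simp
  | succ h ih =>
    have e1 := choose_succ_right_mul (p - 1) h
    have e2 := choose_succ_succ_mul (p + h) h
    rw [Nat.cast_sub (by omega)] at e1
    replace e1 := congrArg (Int.cast : ℤ → ZMod (p ^ 2)) e1
    replace e2 := congrArg (Int.cast : ℤ → ZMod (p ^ 2)) e2
    have ih := ih (by omega)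
    have hu := (isUnit_natCast_zmod_pow (r := 2) (Nat.succ_pos h) hh).pow 2
    have hp2 := natCast_sq_zmod_sq (p := p)
    rw [← hu.mul_right_inj, ← add_assoc]
    push_cast at *
    rw [pow_succ (-1 : ZMod (p ^ 2)) h, ← ih]
    linear_combination ((h : ZMod (p ^ 2)) + 1) * ((p + h + 1).choose (h + 1) : ZMod (p ^ 2)) * e1
      + ((p - 1).choose h : ZMod (p ^ 2)) * (p - 1 - h) * e2
      + ((p - 1).choose h : ZMod (p ^ 2)) * ((p + h).choose h : ZMod (p ^ 2)) * hp2

/-- For `0 < k < p`, `k * C(p, k) * C(p + k, k) ≡ p * (-1) ^ (k - 1)` modulo `p ^ 2`. -/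
theorem mul_legendreCoeff_prime [Fact p.Prime] {k : ℕ} (hk : k + 1 < p) :
    ((k : ZMod (p ^ 2)) + 1) * (legendreCoeff p (k + 1) : ZMod (p ^ 2)) = p * (-1) ^ k := by
  have e1 := choose_succ_succ_mul (p - 1) k
  rw [Nat.sub_add_cancel (by omega), Nat.cast_sub (by omega)] at e1
  have e2 := choose_succ_succ_mul (p + k) k
  replace e1 := congrArg (Int.cast : ℤ → ZMod (p ^ 2)) e1
  replace e2 := congrArg (Int.cast : ℤ → ZMod (p ^ 2)) e2
  have hB := choose_pred_mul_choose_add (p := p) (h := k) (by omega)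
  have hu := isUnit_natCast_zmod_pow (p := p) (r := 2) (Nat.succ_pos k) hk
  have hp2 := natCast_sq_zmod_sq (p := p)
  rw [← hu.mul_right_inj]
  unfold legendreCoeff
  rw [← add_assoc]
  push_cast at *
  linear_combination ((k : ZMod (p ^ 2)) + 1) * ((p + k + 1).choose (k + 1) : ZMod (p ^ 2)) * e1
      + ((p - 1).choose k : ZMod (p ^ 2)) * p * e2 + p * (p + k + 1) * hB + (-1) ^ k * hp2

/-- Both coefficients are killed by p, so their ratio (p+k)/(p-k) matters only modulo p, where it is
-1. -/
theorem legendreCoeff_prime_add_pred [Fact p.Prime] {k : ℕ} (hk : k + 1 < p) :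
    (legendreCoeff p (k + 1) : ZMod (p ^ 2)) + legendreCoeff (p - 1) (k + 1) = 0 := by
  have e := legendreCoeff_succ_left (p - 1) (k + 1)
  rw [Nat.sub_add_cancel (by omega), Nat.cast_sub (by omega)] at e
  have hm := mul_legendreCoeff_prime hk
  replace e := congrArg (Int.cast : ℤ → ZMod (p ^ 2)) e
  have hu := isUnit_natCast_zmod_pow (p := p) (r := 2) (Nat.succ_pos k) hk
  have hp2 := natCast_sq_zmod_sq (p := p)
  rw [← (hu.pow 2).mul_right_inj]
  have hpA : (p : ZMod (p ^ 2)) * legendreCoeff p (k + 1) = 0 := by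
    rw [← hu.mul_right_inj]
    push_cast at *
    linear_combination (p : ZMod (p ^ 2)) * hm + (-1) ^ k * hp2
  have hpB : (p : ZMod (p ^ 2)) * legendreCoeff (p - 1) (k + 1) = 0 := by
    rw [← hu.mul_right_inj]
    push_cast at *
    linear_combination -(p : ZMod (p ^ 2)) * e + (p - (k + 1)) * hpA
      - (legendreCoeff (p - 1) (k + 1) : ZMod (p ^ 2)) * hp2
  push_cast at *
  linear_combination ((k : ZMod (p ^ 2)) + 1) * (-e + hpA - hpB)

theorem legendreCoeff_prime_self [hp : Fact p.Prime] (h3 : 3 < p) :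
    (legendreCoeff p p : ZMod (p ^ 2)) = 2 := by
  have hB := choose_pred_mul_choose_add (p := p) (h := p - 1) (by omega)
  have hev : Even (p - 1) := hp.out.even_sub_one (by omega)
  rw [hev.neg_one_pow] at hB
  have e : legendreCoeff p p = 2 * ((p + (p - 1)).choose (p - 1) : ℤ) := by
    unfold legendreCoeff
    have h := choose_succ_succ_mul (p + (p - 1)) (p - 1)
    rw [show p + (p - 1) + 1 = p + p by omega, Nat.sub_add_cancel (by omega)] at h
    have hp0 : (p : ℤ) ≠ 0 := by exact_mod_cast hp.out.ne_zero
    apply mul_left_cancel₀ hp0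
    push_cast [Nat.cast_sub (show 1 ≤ p by omega)] at h
    rw [Nat.choose_self]
    push_cast
    linear_combination h
  rw [e]
  push_cast at *
  simp only [Nat.choose_self, Nat.cast_one, one_mul] at hB
  rw [hB, mul_one]

theorem delannoy_prime_add_pred [hp : Fact p.Prime] (h3 : 3 < p) :
    (delannoy p : ZMod (p ^ 2)) + delannoy (p - 1) = 4 := by
  obtain ⟨q, rfl⟩ : ∃ q, p = q + 1 := ⟨p - 1, by omega⟩
  rw [delannoy_eq_sum_range (n := q + 1 - 1) (N := q + 1) (by omega), delannoy,
    Finset.sum_range_succ]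
  push_cast
  rw [legendreCoeff_prime_self h3, add_right_comm, ← Finset.sum_add_distrib,
    Finset.sum_range_succ', Finset.sum_eq_zero]
  · simp only [legendreCoeff_zero_right]; push_cast; ring
  · intro k hk
    exact legendreCoeff_prime_add_pred (by simpa using hk)

theorem mul_delannoy_prime [hp : Fact p.Prime] (h3 : 3 < p) :
    (p : ZMod (p ^ 2)) * delannoy p = 3 * p := by
  obtain ⟨q, rfl⟩ : ∃ q, p = q + 1 := ⟨p - 1, by omega⟩
  rw [delannoy, Finset.sum_range_succ, Finset.sum_range_succ']
  push_cast
  rw [legendreCoeff_prime_self h3, legendreCoeff_zero_right, mul_add, mul_add, Finset.mul_sum,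
    Finset.sum_eq_zero]
  · push_cast; ring
  · intro k hk
    have hk : k + 1 < q + 1 := by simpa using hk
    have hm := mul_legendreCoeff_prime hk
    have hu := isUnit_natCast_zmod_pow (p := q + 1) (r := 2) (Nat.succ_pos k) hk
    have hp2 := natCast_sq_zmod_sq (p := q + 1)
    rw [← hu.mul_right_inj]
    push_cast at *
    linear_combination (q + 1 : ZMod ((q + 1) ^ 2)) * hm + (-1) ^ k * hp2

/-- The summand of `intW n + delannoy n`. -/
def sumTerm (n k : ℕ) : ℤ :=
  ((n + k).choose (2 * k) : ℤ) * (centralBinomQuot k + (k.centralBinom : ℤ))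

/-- Adding D_n turns 3/(2k-3) into 2k/(2k-3); the new factor k is the one `mul_legendreCoeff_prime`
needs. -/
theorem mul_sumTerm (n k : ℕ) : (2 * (k : ℤ) - 3) * sumTerm n k = 2 * k * legendreCoeff n k := by
  have q := mul_centralBinomQuot k
  have c := choose_mul_centralBinom n k
  unfold sumTerm
  linear_combination ((n + k).choose (2 * k) : ℤ) * q + 2 * k * c

theorem intW_add_delannoy (n : ℕ) : intW n + delannoy n = ∑ k ∈ range (n + 1), sumTerm n k := by
  unfold intW delannoy sumTerm
  rw [← Finset.sum_add_distrib]
  refine Finset.sum_congr rfl fun k _ => ?_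
  rw [← choose_mul_centralBinom, mul_add]

theorem mul_sumTerm_prime [Fact p.Prime] {k : ℕ} (hk : k + 1 < p) :
    (2 * (k : ZMod (p ^ 2)) - 1) * (sumTerm p (k + 1) : ZMod (p ^ 2)) = 2 * p * (-1) ^ k := by
  have h := congrArg (Int.cast : ℤ → ZMod (p ^ 2)) (mul_sumTerm p (k + 1))
  have h' := mul_legendreCoeff_prime hk
  push_cast at *
  linear_combination h + 2 * h'

theorem isUnit_two_mul_sub_one [hp : Fact p.Prime] {k : ℕ} (hk : k + 1 < p)
    (hm : 2 * k ≠ p + 1) : IsUnit (2 * (k : ZMod (p ^ 2)) - 1) := by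
  have : (2 * (k : ZMod (p ^ 2)) - 1) = ((2 * (k : ℤ) - 1 : ℤ) : ZMod (p ^ 2)) := by push_cast; rfl
  rw [this]
  have hc : IsCoprime (2 * (k : ℤ) - 1) (p : ℤ) := by
    rw [isCoprime_comm, (Nat.prime_iff_prime_int.1 hp.out).coprime_iff_not_dvd]
    rintro ⟨c, hc⟩
    have hc1 : c < 2 := by
      by_contra! h
      nlinarith
    have hc0 : -1 < c := by
      by_contra! h
      nlinarith
    interval_cases c <;> omega
  obtain ⟨u, v, huv⟩ := hc.pow_right (n := 2)
  refine IsUnit.of_mul_eq_one ((u : ℤ) : ZMod (p ^ 2)) ?_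
  have hp2 := natCast_sq_zmod_sq (p := p)
  have := congrArg (Int.cast : ℤ → ZMod (p ^ 2)) huv
  push_cast at *
  linear_combination this - v * hp2

theorem sumTerm_prime_mid [hp : Fact p.Prime] {h : ℕ} (hh : p + 1 = 2 * h) (h3 : 3 < p) :
    9 * (sumTerm p (h + 1) : ZMod (p ^ 2)) = (-1) ^ h * (18 + 12 * p) := by
  have hB := choose_pred_mul_choose_add (p := p) (h := h) (by omega)
  have e := mul_sumTerm p (h + 1)
  have e1 := choose_succ_succ_mul (p - 1) h
  rw [Nat.sub_add_cancel (by omega), Nat.cast_sub (by omega)] at e1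
  have e2 := choose_succ_succ_mul (p + h) h
  have hhz : (p : ℤ) + 1 = 2 * h := by exact_mod_cast hh
  have hp0 : (p : ℤ) ≠ 0 := by exact_mod_cast hp.out.ne_zero
  -- Here 2(h+1) - 3 = p is not a unit, so it is cancelled over the integers before reduction.
  have e3 : ((h : ℤ) + 1) * sumTerm p (h + 1)
      = 2 * (p + h + 1) * (((p - 1).choose h : ℤ) * ((p + h).choose h : ℤ)) := by
    apply mul_left_cancel₀ hp0
    unfold legendreCoeff at e
    rw [← add_assoc] at e
    push_cast at *
    linear_combination (h + 1 : ℤ) * e + (h + 1 : ℤ) * sumTerm p (h + 1) * hhz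
      + 2 * (h + 1 : ℤ) * ((p + h + 1).choose (h + 1) : ℤ) * e1
      + 2 * p * ((p - 1).choose h : ℤ) * e2
  replace e3 := congrArg (Int.cast : ℤ → ZMod (p ^ 2)) e3
  have hhm : (p : ZMod (p ^ 2)) + 1 = 2 * h := by exact_mod_cast congrArg (Nat.cast) hh
  have hp2 := natCast_sq_zmod_sq (p := p)
  push_cast at *
  rw [hB] at e3
  linear_combination (2 * (3 - p : ZMod (p ^ 2))) * e3
    + (3 - p : ZMod (p ^ 2)) * (sumTerm p (h + 1) - 2 * (-1) ^ h) * hhm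
    + (sumTerm p (h + 1) - 6 * (-1) ^ h) * hp2

theorem three_mul_sumTerm_prime_self [hp : Fact p.Prime] (h3 : 3 < p) :
    3 * (sumTerm p p : ZMod (p ^ 2)) = -4 * p := by
  have e := congrArg (Int.cast : ℤ → ZMod (p ^ 2)) (mul_sumTerm p p)
  have hs := legendreCoeff_prime_self h3
  have hu := isUnit_natCast_zmod_pow (p := p) (r := 2) (k := 3) (by norm_num) h3
  have hp2 := natCast_sq_zmod_sq (p := p)
  push_cast at *
  rw [hs] at e
  rw [← hu.mul_right_inj]
  linear_combination -(2 * p + 3 : ZMod (p ^ 2)) * e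
    + (4 * sumTerm p p - 8 : ZMod (p ^ 2)) * hp2

/-- Under k ↦ p+1-k the denominator 2k-1 changes sign modulo p and (-1)^k is fixed. The fixed point
h, where 2h-1 = p, is removed. -/
theorem sum_sumTerm_prime_eq_zero [hp : Fact p.Prime] {h : ℕ} (hh : p + 1 = 2 * h) :
    ∑ k ∈ (Ico 3 (p - 1)).erase h, (sumTerm p (k + 1) : ZMod (p ^ 2)) = 0 := by
  refine Finset.sum_involution (fun k _ => p + 1 - k) ?_ ?_ ?_ ?_
  · intro k hk
    simp only [mem_erase, mem_Ico] at hk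
    have e1 := mul_sumTerm_prime (p := p) (k := k) (by omega)
    have e2 := mul_sumTerm_prime (p := p) (k := p + 1 - k) (by omega)
    have u1 := isUnit_two_mul_sub_one (p := p) (k := k) (by omega) (by omega)
    have u2 := isUnit_two_mul_sub_one (p := p) (k := p + 1 - k) (by omega) (by omega)
    have hs : (-1 : ZMod (p ^ 2)) ^ (p + 1 - k) = (-1) ^ k := by
      apply neg_one_pow_congr
      grind
    have hp2 := natCast_sq_zmod_sq (p := p)
    rw [hs] at e2
    rw [← (u1.mul u2).mul_right_inj]
    push_cast [Nat.cast_sub (show k ≤ p + 1 by omega)] at *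
    linear_combination (2 * (p + 1 - k : ZMod (p ^ 2)) - 1) * e1
      + (2 * (k : ZMod (p ^ 2)) - 1) * e2 + 4 * (-1) ^ k * hp2
  · intro k hk _
    simp only [mem_erase, mem_Ico] at hk
    omega
  · intro k hk
    simp only [mem_erase, mem_Ico] at *
    omega
  · intro k hk
    simp only [mem_erase, mem_Ico] at *
    omega

theorem nine_mul_intW_add_delannoy_prime [hp : Fact p.Prime] {h : ℕ} (hh : p + 1 = 2 * h)
    (h3 : 3 < p) :
    9 * ((intW p : ZMod (p ^ 2)) + delannoy p) = (-1) ^ h * (18 + 12 * p) - 42 * p := by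
  have hp5 : p ≠ 4 := by rintro rfl; exact absurd hp.out (by norm_num)
  obtain ⟨q, hq⟩ : ∃ q, p = q + 1 := ⟨p - 1, by omega⟩
  have hsum := congrArg (Int.cast : ℤ → ZMod (p ^ 2)) (intW_add_delannoy p)
  rw [Finset.sum_range_succ, show range p = range (q + 1) by rw [hq], Finset.sum_range_succ',
    Finset.range_eq_Ico, ← Finset.sum_Ico_consecutive _ (show 0 ≤ 3 by norm_num)
      (show 3 ≤ q by omega), show q = p - 1 by omega,
    ← Finset.add_sum_erase (Ico 3 (p - 1)) _ (show h ∈ Ico 3 (p - 1) by simp; omega)] at hsum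
  have z0 : sumTerm p 0 = 0 := by
    have := mul_sumTerm p 0
    simpa using this
  have z1 := mul_sumTerm_prime (p := p) (k := 0) (by omega)
  have z2 := mul_sumTerm_prime (p := p) (k := 1) (by omega)
  have z3 := mul_sumTerm_prime (p := p) (k := 2) (by omega)
  have zm := sumTerm_prime_mid hh h3
  have zp := three_mul_sumTerm_prime_self h3
  have zs := sum_sumTerm_prime_eq_zero hh
  rw [z0, ← Finset.range_eq_Ico] at hsum
  simp only [Finset.sum_range_succ, Finset.sum_range_zero] at hsum
  push_cast at *
  -- Unpaired terms 1, 2, 3 and p give -18p - 18p + 6p - 12p = -42p.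
  linear_combination 9 * hsum - 9 * z1 + 9 * z2 + 3 * z3 + zm + 3 * zp + 9 * zs

/-! ### The congruence modulo p^3 -/

/-- Multiplication by `p` turns vanishing modulo `p ^ 2` into vanishing modulo `p ^ 3`. -/
theorem natCast_mul_intCast_eq_zero {x : ℤ} (hx : (x : ZMod (p ^ 2)) = 0) :
    (p : ZMod (p ^ 3)) * (x : ZMod (p ^ 3)) = 0 := by
  rw [ZMod.intCast_zmod_eq_zero_iff_dvd] at hx
  have : ((p * x : ℤ) : ZMod (p ^ 3)) = 0 := by
    rw [ZMod.intCast_zmod_eq_zero_iff_dvd]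
    obtain ⟨c, rfl⟩ := hx
    exact ⟨c, by push_cast; ring⟩
  exact_mod_cast this

/-- The value of `p * sumSqForm p w d e` in a ring where `p ^ 3 = 0`, given the relevant
approximations of `w`, `d` and `e`. -/
theorem mul_sumSqForm_of_cube_eq_zero {R : Type*} [CommRing R] {p w d e ε : R} (hp : p ^ 3 = 0)
    (hε : ε ^ 2 = 1) (hde : p * (d + e - 4) = 0) (hd : p * (p * d - 3 * p) = 0)
    (hwd : p * (9 * (w + d) + ε * (18 + 12 * p) + 42 * p) = 0) :
    81 * (p * sumSqForm p w d e)
      = 81 * (8 * ((2 * p - 1) * (2 * p + 1) * (2 * p + 3)) ^ 2 *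
        (12 * p * ε - 17 * p ^ 2)) := by
  have hd2 : p ^ 2 * d = 3 * p ^ 2 := by linear_combination hd
  have he2 : p ^ 2 * e = p ^ 2 := by linear_combination p * hde - hd
  have hw2 : p ^ 2 * (9 * w) = -(18 * ε + 27) * p ^ 2 := by
    linear_combination p * hwd - 9 * hd2 - (12 * ε + 42) * hp
  have low : p * sumSqForm p w d e = -108 * (p * ((d + e) * (w + d)))
      + p ^ 2 * (-360 * w ^ 2 - 792 * w * d - 72 * w * e - 495 * d ^ 2 - 486 * d * e
        + 9 * e ^ 2) := by
    unfold sumSqForm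
    linear_combination ((944 * p - 640 * p ^ 3 + 128 * p ^ 5) * w ^ 2
      + (-360 + 1152 * p + 1152 * p ^ 2 - 576 * p ^ 3 - 576 * p ^ 4) * w * d
      + (120 + 576 * p + 768 * p ^ 2 + 576 * p ^ 3 + 192 * p ^ 4) * w * e
      + (-576 - 360 * p + 432 * p ^ 2 + 360 * p ^ 3) * d ^ 2
      + (-432 + 2160 * p + 3456 * p ^ 2 + 1296 * p ^ 3) * d * e
      + (144 - 72 * p - 432 * p ^ 2 - 216 * p ^ 3) * e ^ 2) * hp
  have h1 : 9 * (p * ((d + e) * (w + d))) = -4 * p * (ε * (18 + 12 * p) + 42 * p) := by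
    linear_combination 9 * (w + d) * hde + 4 * hwd
  have h2 : 81 * (p ^ 2 * w ^ 2) = (18 * ε + 27) ^ 2 * p ^ 2 := by
    linear_combination (9 * w - (18 * ε + 27)) * hw2
  have h3 : 9 * (p ^ 2 * (w * d)) = -3 * (18 * ε + 27) * p ^ 2 := by
    linear_combination 9 * w * hd2 + 3 * hw2
  have h4 : 9 * (p ^ 2 * (w * e)) = -(18 * ε + 27) * p ^ 2 := by
    linear_combination 9 * w * he2 + hw2
  have h5 : p ^ 2 * d ^ 2 = 9 * p ^ 2 := by linear_combination (d + 3) * hd2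
  have h6 : p ^ 2 * (d * e) = 3 * p ^ 2 := by linear_combination e * hd2 + 3 * he2
  have h7 : p ^ 2 * e ^ 2 = p ^ 2 := by linear_combination (e + 1) * he2
  linear_combination 81 * low - 972 * h1 - 360 * h2 - 9 * 792 * h3 - 648 * h4
    - 81 * 495 * h5 - 81 * 486 * h6 + 729 * h7 - 360 * 324 * p ^ 2 * hε
    - 81 * (-17 * 96 + (-544 - 768 * p + 896 * p ^ 2 + 1536 * p ^ 3 + 512 * p ^ 4)
      * (12 * ε - 17 * p)) * hp

theorem sum_sq_intW_prime [hp : Fact p.Prime] (h3 : 3 < p) :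
    ((∑ k ∈ range p, (2 * (k : ℤ) + 1) * intW k ^ 2 : ℤ) : ZMod (p ^ 3))
      = 12 * p * (-1) ^ ((p - 1) / 2) - 17 * p ^ 2 := by
  obtain ⟨m, hm⟩ : ∃ m, p = 2 * m + 1 := hp.out.odd_of_ne_two (by omega)
  rw [show (p - 1) / 2 = m by omega]
  have hsum := weighted_sum_sq_intW (p - 1)
  rw [Nat.cast_sub (by omega), Nat.sub_add_cancel (by omega)] at hsum
  simp only [Nat.cast_one, sub_add_cancel] at hsum
  set S := ∑ k ∈ range p, (2 * (k : ℤ) + 1) * intW k ^ 2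
  have hde := natCast_mul_intCast_eq_zero (p := p) (x := delannoy p + delannoy (p - 1) - 4)
    (by push_cast; rw [delannoy_prime_add_pred h3, sub_self])
  have hd := natCast_mul_intCast_eq_zero (p := p) (x := p * delannoy p - 3 * p)
    (by push_cast; rw [mul_delannoy_prime h3, sub_self])
  have hwd := natCast_mul_intCast_eq_zero (p := p)
    (x := 9 * (intW p + delannoy p) + (-1) ^ m * (18 + 12 * p) + 42 * p)
    (by
      have := nine_mul_intW_add_delannoy_prime (p := p) (h := m + 1) (by omega) h3
      rw [pow_succ (-1 : ZMod (p ^ 2)) m] at this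
      push_cast
      linear_combination this)
  push_cast at hde hd hwd
  have hcube : (p : ZMod (p ^ 3)) ^ 3 = 0 := by exact_mod_cast ZMod.natCast_self (p ^ 3)
  have key := mul_sumSqForm_of_cube_eq_zero hcube
    (show ((-1 : ZMod (p ^ 3)) ^ m) ^ 2 = 1 by rw [← pow_mul, mul_comm, pow_mul]; simp)
    hde hd hwd
  have hsum' := congrArg (Int.cast : ℤ → ZMod (p ^ 3)) hsum
  unfold sumSqForm at key hsum'
  push_cast at hsum'
  have u3 : IsUnit (3 : ZMod (p ^ 3)) := by
    exact_mod_cast isUnit_natCast_zmod_pow (p := p) (r := 3) (k := 3) (by norm_num) h3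
  have u2 : IsUnit (2 : ZMod (p ^ 3)) := by
    exact_mod_cast isUnit_natCast_zmod_pow (p := p) (r := 3) (k := 2) (by norm_num) (by omega)
  have uc : IsUnit ((2 * (p : ZMod (p ^ 3)) - 1) * (2 * p + 1) * (2 * p + 3)) := by
    -- The product is this nilpotent minus 3, hence a unit.
    have hnil : IsNilpotent ((p : ZMod (p ^ 3)) * (8 * p ^ 2 + 12 * p - 2)) :=
      (Commute.all _ _).isNilpotent_mul_right ⟨3, hcube⟩
    have := hnil.isUnit_add_right_of_commute u3.neg (Commute.all _ _)
    convert this using 1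
    ring
  have hu := (u3.pow 4).mul ((u2.pow 3).mul (uc.pow 2))
  rw [← hu.mul_right_inj]
  linear_combination 81 * hsum' + key

end PrimeSq

theorem theorem2 :
    ∃ w : ℕ → ℤ, (∀ k : ℕ, (w k : ℚ) = W k) ∧
      (∀ n : ℕ, 0 < n →
        9 * ∑ k ∈ Finset.range n, (2 * (k : ℤ) + 1) * w k ^ 2 ≡ 0 [ZMOD (n : ℤ)]) ∧
      (∀ p : ℕ, p.Prime → 3 < p →
        ∑ k ∈ Finset.range p, (2 * (k : ℤ) + 1) * w k ^ 2
          ≡ 12 * (p : ℤ) * (-1) ^ ((p - 1) / 2) - 17 * (p : ℤ) ^ 2 [ZMOD (p : ℤ) ^ 3]) := by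
  refine ⟨intW, intW_cast, fun n hn => (nine_mul_sum_dvd n hn).modEq_zero_int, fun p hp h3 => ?_⟩
  have := Fact.mk hp
  have h := sum_sq_intW_prime h3
  rw [← Nat.cast_pow, ← ZMod.intCast_eq_intCast_iff]
  rw [h]
  push_cast
  rfl
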